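/- \textbf{Lemma (Ellipsoidal covering of the Grassmannian manifold).} For integers $0\le r\le d$ let $\mathrm{Gr}(d,r)$ be the set of $r$-dimensional linear subspaces of $\mathbb{R}^d$, and let $\mu=\mathrm{Unif}(\mathrm{Gr}(d,r))$ be the rotation invariant Borel probability measure on it, that is, the law of $U\mathcal{V}_0$ for a Haar distributed $U\in O(d)$ and a fixed $\mathcal{V}_0\in\mathrm{Gr}(d,r)$. For $\mathcal{V}\in\mathrm{Gr}(d,r)$ let $\mathcal{P}_{\mathcal{V}}$ be the orthogonal projector onto $\mathcal{V}$. For a positive semidefinite matrix $\Sigma\in\mathbb{R}^{d\times d}$ put $$\varrho_{\mathrm{proj},\Sigma}(\mathcal{V},\bar{\mathcal{V}})=\bigl\|\Sigma^{1/2}(\mathcal{P}_{\mathcal{V}}-\mathcal{P}_{\bar{\mathcal{V}}})\bigr\|_{\mathrm{op}},\qquad B_{\varrho_{\mathrm{proj},\Sigma}}(\mathcal{V},\varepsilon)=\{\bar{\mathcal{V}}\in\mathrm{Gr}(d,r):\varrho_{\mathrm{proj},\Sigma}(\mathcal{V},\bar{\mathcal{V}})\le\varepsilon\}.$$ There is an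 absolute constant $C>0$ such that for all integers $0\le r\le d$, every $\mathcal{V}\in\mathrm{Gr}(d,r)$, every $\varepsilon>0$ and every positive semidefinite $\Sigma\in\mathbb{R}^{d\times d}$ with eigenvalues $\lambda_1\ge\cdots\ge\lambda_d\ge 0$ (counted with multiplicity), the ball $B_{\varrho_{\mathrm{proj},\Sigma}}(\mathcal{V},\varepsilon)$ has positive measure and $$\log\frac{1}{\mu\bigl(B_{\varrho_{\mathrm{proj},\Sigma}}(\mathcal{V},\varepsilon)\bigr)}\le\frac{d-r}{2}\sum_{k=1}^{r}\log\frac{C\max\{\lambda_k,\varepsilon^2\}}{\varepsilon^2}+\frac{r}{2}\sum_{k=1}^{d-r}\log\frac{C\max\{\lambda_k,\varepsilon^2\}}{\varepsilon^2}.$$ -/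

import Mathlib

noncomputable section

open scoped MatrixOrder

namespace GrassmannCover

/-- Euclidean space `ℝ^d`, with the `ℓ²` norm and inner product. -/
abbrev Euc (d : ℕ) : Type := EuclideanSpace ℝ (Fin d)

/-- `Gr(d, r)`: the `r`-dimensional linear subspaces of `ℝ^d`. -/
def Gr (d r : ℕ) : Type := {V : Submodule ℝ (Euc d) // Module.finrank ℝ V = r}

/-- The orthogonal projector onto the subspace `V`. -/
def proj {d r : ℕ} (V : Gr d r) : Euc d →L[ℝ] Euc d := V.1.starProjection

/-- The Borel `σ`-algebra of `Gr(d, r)`, embedded in the space of linear operators through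
`V ↦ P_V` (this is the embedding that induces the usual topology of the Grassmannian). -/
instance (d r : ℕ) : MeasurableSpace (Gr d r) :=
  MeasurableSpace.comap (proj (d := d) (r := r)) inferInstance

/-- The orthogonal group `O(d)`: operators `U` on `ℝ^d` with `Uᵀ U = U Uᵀ = 1`, with the topology
of the operator norm. -/
abbrev OGroup (d : ℕ) : Type := unitary (Euc d →L[ℝ] Euc d)

instance (d : ℕ) : ContinuousStar (Euc d →L[ℝ] Euc d) :=
  ⟨(ContinuousLinearMap.adjoint (𝕜 := ℝ) (E := Euc d) (F := Euc d)).continuous⟩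

instance (d : ℕ) : CompactSpace (OGroup d) := by
  apply isCompact_iff_compactSpace.mp
  apply Metric.isCompact_of_isClosed_isBounded
  · have h : ((unitary (Euc d →L[ℝ] Euc d) : Submonoid _) : Set (Euc d →L[ℝ] Euc d)) =
        {U | star U * U = 1} ∩ {U | U * star U = 1} := by
      ext U
      exact Unitary.mem_iff
    rw [h]
    exact (isClosed_eq (by fun_prop) continuous_const).inter
      (isClosed_eq (by fun_prop) continuous_const)
  · refine (Metric.isBounded_closedBall (x := (0 : Euc d →L[ℝ] Euc d)) (r := 1)).subset ?_
    intro U hU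
    rw [mem_closedBall_zero_iff]
    refine ContinuousLinearMap.opNorm_le_bound _ zero_le_one fun x => ?_
    rw [one_mul]
    exact (Unitary.norm_map (⟨U, hU⟩ : OGroup d) x).le

/-- The image `U V` of a subspace `V` under an orthogonal map `U`. -/
def rotate {d r : ℕ} (U : OGroup d) (V : Gr d r) : Gr d r :=
  ⟨V.1.map (Unitary.linearIsometryEquiv U).toLinearEquiv.toLinearMap,
    (LinearEquiv.finrank_map_eq _ _).trans V.2⟩

theorem proj_rotate {d r : ℕ} (U : OGroup d) (V : Gr d r) :
    proj (rotate U V) = (U : Euc d →L[ℝ] Euc d) * proj V * star (U : Euc d →L[ℝ] Euc d) := by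
  ext1 x
  exact Submodule.starProjection_map_apply (Unitary.linearIsometryEquiv U) V.1 x

theorem measurable_rotate {d r : ℕ} (V : Gr d r) : Measurable fun U : OGroup d => rotate U V := by
  refine measurable_comap_iff.mpr ?_
  have h : (proj ∘ fun U : OGroup d => rotate U V) =
      fun U : OGroup d => (U : Euc d →L[ℝ] Euc d) * proj V * star (U : Euc d →L[ℝ] Euc d) := by
    funext U
    exact proj_rotate U V
  rw [h]
  exact Continuous.measurable (by fun_prop)

/-- The coordinate subspace spanned by the first `r` standard basis vectors. -/
def coordSubspace {d r : ℕ} (hr : r ≤ d) : Gr d r :=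
  ⟨Submodule.span ℝ (Set.range fun i : Fin r =>
      (EuclideanSpace.single (Fin.castLE hr i) (1 : ℝ) : Euc d)), by
    have h : LinearIndependent ℝ fun i : Fin r =>
        (EuclideanSpace.single (Fin.castLE hr i) (1 : ℝ) : Euc d) :=
      ((EuclideanSpace.orthonormal_single (𝕜 := ℝ) (ι := Fin d)).comp _
        (Fin.castLE_injective hr)).linearIndependent
    simpa using finrank_span_eq_card h⟩

/-- The Haar probability measure of the compact group `O(d)`. -/
def haarO (d : ℕ) : MeasureTheory.Measure (OGroup d) := MeasureTheory.Measure.haarMeasure ⊤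

/-- `Unif(Gr(d, r))`: the law of `U V₀` for a Haar distributed `U ∈ O(d)` and a fixed
`r`-dimensional subspace `V₀`. It is the rotation invariant probability measure on `Gr(d, r)`
(see `uniformGr_univ`, `uniformGr_map_rotate`), so it does not depend on the choice of `V₀`. -/
def uniformGr {d r : ℕ} (hr : r ≤ d) : MeasureTheory.Measure (Gr d r) :=
  (haarO d).map fun U => rotate U (coordSubspace hr)

theorem uniformGr_univ {d r : ℕ} (hr : r ≤ d) : uniformGr hr Set.univ = 1 := by
  rw [uniformGr, MeasureTheory.Measure.map_apply (measurable_rotate _) MeasurableSet.univ,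
    Set.preimage_univ]
  exact MeasureTheory.Measure.haarMeasure_self (K₀ := (⊤ : TopologicalSpace.PositiveCompacts (OGroup d)))

theorem rotate_mul {d r : ℕ} (U W : OGroup d) (V : Gr d r) :
    rotate (U * W) V = rotate U (rotate W V) := by
  apply Subtype.ext
  change V.1.map _ = (V.1.map _).map _
  rw [← Submodule.map_comp, map_mul]
  rfl

theorem measurable_rotate_left {d r : ℕ} (U : OGroup d) :
    Measurable fun V : Gr d r => rotate U V := by
  refine measurable_comap_iff.mpr ?_
  have h : (proj ∘ fun V : Gr d r => rotate U V) =
      (fun A : Euc d →L[ℝ] Euc d => (U : Euc d →L[ℝ] Euc d) * A *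
        star (U : Euc d →L[ℝ] Euc d)) ∘ proj := by
    funext V
    exact proj_rotate U V
  rw [h]
  exact (Continuous.measurable (by fun_prop)).comp (comap_measurable _)

theorem uniformGr_map_rotate {d r : ℕ} (hr : r ≤ d) (U : OGroup d) :
    (uniformGr hr).map (fun V => rotate U V) = uniformGr hr := by
  have h : (haarO d).map (fun W => U * W) = haarO d :=
    MeasureTheory.map_mul_left_eq_self (MeasureTheory.Measure.haarMeasure ⊤) U
  conv_rhs => rw [uniformGr, ← h]
  rw [uniformGr, MeasureTheory.Measure.map_map (measurable_rotate_left U) (measurable_rotate _),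
    MeasureTheory.Measure.map_map (measurable_rotate _) (measurable_const_mul U)]
  congr 1
  funext W
  exact (rotate_mul U W _).symm

/-- The ellipsoidal projection metric `‖S^{1/2} (P_V - P_W)‖_op`, where `S^{1/2}` is the positive
semidefinite square root of the positive semidefinite matrix `S`. -/
def ellDist {d r : ℕ} (S : Matrix (Fin d) (Fin d) ℝ) (V W : Gr d r) : ℝ :=
  ‖Matrix.toEuclideanCLM (n := Fin d) (𝕜 := ℝ) (CFC.sqrt S) ∘L (proj V - proj W)‖

/-- The closed ball of radius `ε` around `V` in the ellipsoidal projection metric. -/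
def ellBall {d r : ℕ} (S : Matrix (Fin d) (Fin d) ℝ) (V : Gr d r) (ε : ℝ) : Set (Gr d r) :=
  {W | ellDist S V W ≤ ε}

/-- The eigenvalues of a symmetric matrix, with multiplicity and in decreasing order
(so `eigval h 0` is the largest one). -/
def eigval {d : ℕ} {S : Matrix (Fin d) (Fin d) ℝ} (h : S.IsHermitian) (k : Fin d) : ℝ :=
  h.eigenvalues₀ (Fin.cast (Fintype.card_fin d).symm k)

end GrassmannCover

end

noncomputable section

/-!
Let `A = S^{1/2}`. If `D₁` and `D₂` are self-adjoint contractions of `V` and `Vᗮ` that shrink the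
singular values of `A` restricted to `V` and to `Vᗮ` down to `ε`, then for `‖Y‖ ≤ 1 / 2` the graph
of `X = D₂ Y D₁ : V → Vᗮ` lies in the ball, because the difference of the two projectors is
controlled by `A X` on `V` and by `A X*` on `Vᗮ`.

To bound the measure of this set of graphs from below, average a Haar measure of `Hom(V, ℝ^d)` over
`O(d)`: by Tonelli, the uniform measure of a set of subspaces is at least the proportion of the unit
ball of `Hom(V, ℝ^d)` that consists of maps whose range belongs to the set. The maps `(M, X M)` with
`M` close to `1 / 4` have the graph of `X` as their range, and they fill a proportion of order
`8^{-rd} |det D₂|^r |det D₁|^{d-r}`. The singular values of a restriction of `A` are at most those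
of `A`, which bounds both determinants by the largest singular values of `A`.

Passing to orthogonal complements preserves the measure and the distance, so that one may assume
`r ≤ d - r`; then `8^{rd} ≤ 64^{r(d-r)}`.
-/

namespace GrassmannCover

open MeasureTheory Metric Module

section SingularValues

variable {𝕜 E F G : Type*} [RCLike 𝕜]
  [NormedAddCommGroup E] [InnerProductSpace 𝕜 E]
  [NormedAddCommGroup F] [InnerProductSpace 𝕜 F]
  [NormedAddCommGroup G] [InnerProductSpace 𝕜 G]

theorem finrank_span_image_orthonormalBasis {ι : Type*} [Fintype ι]
    (b : OrthonormalBasis ι 𝕜 E) (s : Finset ι) :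
    finrank 𝕜 (Submodule.span 𝕜 (b '' s)) = s.card := by
  have hli := b.orthonormal.linearIndependent.comp ((↑) : s → ι) Subtype.val_injective
  have hrange : Set.range (b ∘ ((↑) : s → ι)) = b '' s := by
    rw [Set.range_comp, Subtype.range_coe]
  rw [← hrange, finrank_span_eq_card hli, Fintype.card_coe]

theorem repr_eq_zero_of_mem_span_image {ι : Type*} [Fintype ι]
    (b : OrthonormalBasis ι 𝕜 E) {s : Set ι} {x : E} (hx : x ∈ Submodule.span 𝕜 (b '' s))
    {i : ι} (hi : i ∉ s) : b.repr x i = 0 := by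
  rw [← b.coe_toBasis] at hx
  by_contra h
  exact hi (b.toBasis.mem_span_image.1 hx (by simpa using h))

variable [FiniteDimensional 𝕜 E] [FiniteDimensional 𝕜 F] [FiniteDimensional 𝕜 G]

theorem exists_orthonormalBasis_norm_apply_sq_eq_sum (A : E →ₗ[𝕜] G) :
    ∃ b : OrthonormalBasis (Fin (finrank 𝕜 E)) 𝕜 E, ∀ x,
      ‖A x‖ ^ 2 = ∑ i : Fin (finrank 𝕜 E), A.singularValues i ^ 2 * ‖b.repr x i‖ ^ 2 := by
  have hA := A.isSymmetric_adjoint_comp_self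
  refine ⟨hA.eigenvectorBasis rfl, fun x => ?_⟩
  have hinner : ‖A x‖ ^ 2 = RCLike.re (inner 𝕜 x ((A.adjoint ∘ₗ A) x)) := by
    rw [LinearMap.comp_apply, LinearMap.adjoint_inner_right, inner_self_eq_norm_sq]
  rw [hinner, ← (hA.eigenvectorBasis rfl).repr.inner_map_map, PiLp.inner_apply, map_sum]
  refine Finset.sum_congr rfl fun i _ => ?_
  rw [hA.eigenvectorBasis_apply_self_apply rfl, ← A.sq_singularValues_fin rfl, ← smul_eq_mul,
    inner_smul_right, inner_self_eq_norm_sq_to_K]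
  norm_cast

theorem exists_submodule_singularValue_mul_norm_le (A : E →ₗ[𝕜] G) {k : ℕ}
    (hk : k < finrank 𝕜 E) :
    ∃ U : Submodule 𝕜 E, finrank 𝕜 U = k + 1 ∧ ∀ x ∈ U, A.singularValues k * ‖x‖ ≤ ‖A x‖ := by
  obtain ⟨b, hb⟩ := exists_orthonormalBasis_norm_apply_sq_eq_sum A
  refine ⟨Submodule.span 𝕜 (b '' (Finset.Iic ⟨k, hk⟩ : Finset (Fin _))), ?_, fun x hx => ?_⟩
  · rw [finrank_span_image_orthonormalBasis, Fin.card_Iic]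
  · refine le_of_sq_le_sq ?_ (norm_nonneg _)
    rw [hb, mul_pow, ← b.repr.norm_map, EuclideanSpace.norm_sq_eq, Finset.mul_sum]
    refine Finset.sum_le_sum fun i _ => ?_
    by_cases hi : i ≤ ⟨k, hk⟩
    · gcongr
      · exact A.singularValues_nonneg k
      · exact A.singularValues_antitone hi
    · simp [repr_eq_zero_of_mem_span_image b hx (show i ∉ _ by simpa using hi)]

theorem exists_submodule_norm_le_singularValue_mul (A : E →ₗ[𝕜] G) {k : ℕ}
    (hk : k < finrank 𝕜 E) :
    ∃ U : Submodule 𝕜 E, finrank 𝕜 U = finrank 𝕜 E - k ∧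
      ∀ x ∈ U, ‖A x‖ ≤ A.singularValues k * ‖x‖ := by
  obtain ⟨b, hb⟩ := exists_orthonormalBasis_norm_apply_sq_eq_sum A
  refine ⟨Submodule.span 𝕜 (b '' (Finset.Ici ⟨k, hk⟩ : Finset (Fin _))), ?_, fun x hx => ?_⟩
  · rw [finrank_span_image_orthonormalBasis, Fin.card_Ici]
  · refine le_of_sq_le_sq ?_ (mul_nonneg (A.singularValues_nonneg k) (norm_nonneg x))
    rw [hb, mul_pow, ← b.repr.norm_map, EuclideanSpace.norm_sq_eq, Finset.mul_sum]
    refine Finset.sum_le_sum fun i _ => ?_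
    by_cases hi : ⟨k, hk⟩ ≤ i
    · gcongr
      · exact A.singularValues_nonneg i
      · exact A.singularValues_antitone hi
    · simp [repr_eq_zero_of_mem_span_image b hx (show i ∉ _ by simpa using hi)]

theorem singularValues_comp_linearIsometry_le (A : E →ₗ[𝕜] G) (J : F →ₗᵢ[𝕜] E) (k : ℕ) :
    (A ∘ₗ J.toLinearMap).singularValues k ≤ A.singularValues k := by
  rcases le_or_gt (finrank 𝕜 F) k with hk | hk
  · rw [LinearMap.singularValues_of_finrank_le _ hk]
    exact A.singularValues_nonneg k
  have hFE : finrank 𝕜 F ≤ finrank 𝕜 E := LinearMap.finrank_le_finrank_of_injective J.injective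
  obtain ⟨U, hU, hlow⟩ := exists_submodule_singularValue_mul_norm_le (A ∘ₗ J.toLinearMap) hk
  obtain ⟨W, hW, hhigh⟩ := exists_submodule_norm_le_singularValue_mul A (hk.trans_le hFE)
  have hmeet : ¬Disjoint (U.map J.toLinearMap) W := fun h => by
    have hdim := Submodule.finrank_add_finrank_le_of_disjoint h
    rw [← (U.equivMapOfInjective J.toLinearMap J.injective).finrank_eq] at hdim
    omega
  obtain ⟨u, huU, huW, hu⟩ : ∃ u ∈ U, J u ∈ W ∧ J u ≠ 0 := by
    simpa [Submodule.disjoint_def] using hmeet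
  refine le_of_mul_le_mul_right ((hlow u huU).trans ?_) ?_
  · simpa using hhigh _ huW
  · exact norm_pos_iff.2 fun h => hu (by rw [h, map_zero])

end SingularValues

section Contraction

/-- The largest factor in `(0, 1]` that brings a singular value `σ` down to at most `ε`. -/
def contractionFactor (ε σ : ℝ) : ℝ := ε / max σ ε

theorem contractionFactor_pos {ε : ℝ} (hε : 0 < ε) (σ : ℝ) : 0 < contractionFactor ε σ :=
  div_pos hε (lt_max_of_lt_right hε)

theorem contractionFactor_le_one {ε : ℝ} (hε : 0 < ε) (σ : ℝ) : contractionFactor ε σ ≤ 1 :=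
  div_le_one_of_le₀ (le_max_right σ ε) (lt_max_of_lt_right hε).le

theorem mul_contractionFactor_le {ε : ℝ} (hε : 0 < ε) (σ : ℝ) :
    σ * contractionFactor ε σ ≤ ε := by
  rw [contractionFactor, mul_div_assoc', mul_comm σ, mul_div_assoc]
  exact mul_le_of_le_one_right hε.le
    (div_le_one_of_le₀ (le_max_left σ ε) (lt_max_of_lt_right hε).le)

theorem contractionFactor_antitone {ε : ℝ} (hε : 0 < ε) : Antitone (contractionFactor ε) :=
  fun _ _ h => div_le_div_of_nonneg_left hε.le (lt_max_of_lt_right hε) (max_le_max_right ε h)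

/-- The product of the first `n` contraction factors of the sequence `σ`: the determinant of the
contraction that reduces the singular values `σ 0, …, σ (n - 1)` to at most `ε`. -/
def contractionProduct (ε : ℝ) (σ : ℕ → ℝ) (n : ℕ) : ℝ :=
  ∏ k ∈ Finset.range n, contractionFactor ε (σ k)

theorem contractionProduct_pos {ε : ℝ} (hε : 0 < ε) (σ : ℕ → ℝ) (n : ℕ) :
    0 < contractionProduct ε σ n :=
  Finset.prod_pos fun k _ => contractionFactor_pos hε (σ k)

theorem contractionProduct_anti {ε : ℝ} (hε : 0 < ε) {σ τ : ℕ → ℝ} (h : ∀ k, σ k ≤ τ k) (n : ℕ) :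
    contractionProduct ε τ n ≤ contractionProduct ε σ n :=
  Finset.prod_le_prod (fun k _ => (contractionFactor_pos hε (τ k)).le) fun k _ =>
    contractionFactor_antitone hε (h k)

theorem log_contractionFactor {ε : ℝ} (hε : 0 < ε) {σ : ℝ} (hσ : 0 ≤ σ) :
    Real.log (contractionFactor ε σ) = -(1 / 2) * Real.log (max (σ ^ 2) (ε ^ 2) / ε ^ 2) := by
  have hmax : max (σ ^ 2) (ε ^ 2) = max σ ε ^ 2 :=
    (pow_left_monotoneOn.map_max (s := {x : ℝ | 0 ≤ x}) hσ hε.le).symm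
  rw [hmax, ← div_pow, Real.log_pow, contractionFactor, ← inv_div (max σ ε) ε, Real.log_inv]
  push_cast
  ring

theorem sum_log_mul_max_div_sq {C ε : ℝ} (hC : 0 < C) (hε : 0 < ε) {σ : ℕ → ℝ} (hσ : ∀ k, 0 ≤ σ k)
    (n : ℕ) :
    ∑ k : Fin n, Real.log (C * max (σ k ^ 2) (ε ^ 2) / ε ^ 2) =
      n * Real.log C - 2 * Real.log (contractionProduct ε σ n) := by
  have hterm : ∀ k : ℕ, Real.log (C * max (σ k ^ 2) (ε ^ 2) / ε ^ 2) =
      Real.log C - 2 * Real.log (contractionFactor ε (σ k)) := fun k => by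
    have hmax : 0 < max (σ k ^ 2) (ε ^ 2) := lt_max_of_lt_right (by positivity)
    rw [mul_div_assoc, Real.log_mul hC.ne' (div_pos hmax (by positivity)).ne',
      log_contractionFactor hε (hσ k)]
    ring
  rw [contractionProduct, Real.log_prod fun k _ => (contractionFactor_pos hε _).ne',
    Finset.sum_range, Finset.mul_sum]
  simp only [hterm, Finset.sum_sub_distrib, Finset.sum_const, Finset.card_univ, Fintype.card_fin,
    nsmul_eq_mul]

variable {𝕜 E G : Type*} [RCLike 𝕜]
  [NormedAddCommGroup E] [InnerProductSpace 𝕜 E] [FiniteDimensional 𝕜 E]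
  [NormedAddCommGroup G] [InnerProductSpace 𝕜 G] [FiniteDimensional 𝕜 G]

/-- The operator that multiplies the `i`-th coordinate in an orthonormal basis by the real
number `α i`. -/
def diagonalOperator {ι : Type*} [Fintype ι] [DecidableEq ι] (b : OrthonormalBasis ι 𝕜 E)
    (α : ι → ℝ) : E →L[𝕜] E :=
  (Matrix.toLin b.toBasis b.toBasis (Matrix.diagonal fun i => (α i : 𝕜))).toContinuousLinearMap

theorem repr_diagonalOperator {ι : Type*} [Fintype ι] [DecidableEq ι]
    (b : OrthonormalBasis ι 𝕜 E) (α : ι → ℝ) (x : E) (i : ι) :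
    b.repr (diagonalOperator b α x) i = α i * b.repr x i := by
  have h := congrFun (Matrix.repr_toLin b.toBasis b.toBasis
    (Matrix.diagonal fun i => (α i : 𝕜)) x) i
  simpa [diagonalOperator, Matrix.mulVec_diagonal] using h

theorem isSymmetric_diagonalOperator {ι : Type*} [Fintype ι] [DecidableEq ι]
    (b : OrthonormalBasis ι 𝕜 E) (α : ι → ℝ) :
    (diagonalOperator b α).toLinearMap.IsSymmetric := by
  intro x y
  simp only [ContinuousLinearMap.coe_coe]
  rw [← b.repr.inner_map_map, ← b.repr.inner_map_map, PiLp.inner_apply, PiLp.inner_apply]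
  refine Finset.sum_congr rfl fun i _ => ?_
  rw [repr_diagonalOperator, repr_diagonalOperator, ← smul_eq_mul, ← smul_eq_mul,
    inner_smul_left, inner_smul_right, RCLike.conj_ofReal]

theorem det_diagonalOperator {ι : Type*} [Fintype ι] [DecidableEq ι]
    (b : OrthonormalBasis ι 𝕜 E) (α : ι → ℝ) : (diagonalOperator b α).det = ∏ i, (α i : 𝕜) := by
  rw [diagonalOperator, LinearMap.det_toContinuousLinearMap, LinearMap.det_toLin,
    Matrix.det_diagonal]

theorem exists_isSymmetric_norm_comp_le (A : E →L[𝕜] G) {ε : ℝ} (hε : 0 < ε) :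
    ∃ D : E →L[𝕜] E, D.toLinearMap.IsSymmetric ∧ ‖D‖ ≤ 1 ∧ ‖A ∘L D‖ ≤ ε ∧
      D.det = (contractionProduct ε A.toLinearMap.singularValues (finrank 𝕜 E) : 𝕜) := by
  obtain ⟨b, hb⟩ := exists_orthonormalBasis_norm_apply_sq_eq_sum A.toLinearMap
  let α : Fin (finrank 𝕜 E) → ℝ := fun k => contractionFactor ε (A.toLinearMap.singularValues k)
  have hdet : (diagonalOperator b α).det =
      (contractionProduct ε A.toLinearMap.singularValues (finrank 𝕜 E) : 𝕜) := by
    rw [det_diagonalOperator, contractionProduct, Finset.prod_range, RCLike.ofReal_prod]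
  have hα : ∀ i, 0 ≤ α i := fun i => (contractionFactor_pos hε _).le
  have hrepr : ∀ x i, ‖b.repr (diagonalOperator b α x) i‖ = α i * ‖b.repr x i‖ := fun x i => by
    rw [repr_diagonalOperator, norm_mul, RCLike.norm_of_nonneg (hα i)]
  refine ⟨diagonalOperator b α, isSymmetric_diagonalOperator b α,
    ContinuousLinearMap.opNorm_le_bound _ zero_le_one fun x => ?_,
    ContinuousLinearMap.opNorm_le_bound _ hε.le fun x => ?_, hdet⟩
  · rw [one_mul, ← b.repr.norm_map, ← b.repr.norm_map x]
    refine le_of_sq_le_sq ?_ (norm_nonneg _)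
    rw [EuclideanSpace.norm_sq_eq, EuclideanSpace.norm_sq_eq]
    refine Finset.sum_le_sum fun i _ => ?_
    rw [hrepr]
    exact pow_le_pow_left₀ (mul_nonneg (hα i) (norm_nonneg _))
      (mul_le_of_le_one_left (norm_nonneg _) (contractionFactor_le_one hε _)) 2
  · refine le_of_sq_le_sq ?_ (mul_nonneg hε.le (norm_nonneg x))
    rw [mul_pow, ← b.repr.norm_map x, EuclideanSpace.norm_sq_eq, Finset.mul_sum]
    refine (hb _).trans_le (Finset.sum_le_sum fun i _ => ?_)
    rw [ContinuousLinearMap.coe_coe, hrepr, ← mul_pow, ← mul_assoc, mul_pow]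
    gcongr
    · exact mul_nonneg (A.toLinearMap.singularValues_nonneg i) (hα i)
    · exact mul_contractionFactor_le hε _

end Contraction

section Determinants

open scoped Kronecker in
theorem toMatrix_compRight_comp_lcomp {R M N ι κ : Type*} [CommRing R]
    [AddCommGroup M] [Module R M] [AddCommGroup N] [Module R N]
    [Fintype ι] [DecidableEq ι] [Fintype κ] [DecidableEq κ]
    (b : Basis ι R M) (c : Basis κ R N) (f : M →ₗ[R] M) (g : N →ₗ[R] N) :
    LinearMap.toMatrix (b.linearMap c) (b.linearMap c)
        (LinearMap.compRight R g ∘ₗ LinearMap.lcomp R N f) =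
      LinearMap.toMatrix c c g ⊗ₖ (LinearMap.toMatrix b b f).transpose := by
  ext ⟨i, j⟩ ⟨k, l⟩
  have hY : (b.linearMap c (k, l)) (f (b j)) = (b.repr (f (b j)) l) • c k := by
    conv_lhs => rw [← b.sum_repr (f (b j)), map_sum]
    simp only [map_smul, Basis.linearMap_apply_apply, smul_ite, smul_zero, Finset.sum_ite_eq,
      Finset.mem_univ, if_true]
  rw [LinearMap.toMatrix_apply, Matrix.kroneckerMap_apply, Matrix.transpose_apply,
    LinearMap.toMatrix_apply, LinearMap.toMatrix_apply, Basis.linearMap_repr_apply]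
  change LinearMap.toMatrix b c (g ∘ₗ b.linearMap c (k, l) ∘ₗ f) i j = _
  rw [LinearMap.toMatrix_apply, LinearMap.comp_apply, LinearMap.comp_apply, hY, map_smul, map_smul,
    Finsupp.smul_apply, smul_eq_mul, mul_comm]

theorem det_compRight_comp_lcomp {R M N : Type*} [CommRing R]
    [AddCommGroup M] [Module R M] [Module.Free R M] [Module.Finite R M]
    [AddCommGroup N] [Module R N] [Module.Free R N] [Module.Finite R N]
    (f : M →ₗ[R] M) (g : N →ₗ[R] N) :
    LinearMap.det (LinearMap.compRight R g ∘ₗ LinearMap.lcomp R N f) =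
      LinearMap.det g ^ finrank R M * LinearMap.det f ^ finrank R N := by
  classical
  nontriviality R
  let b := Module.Free.chooseBasis R M
  let c := Module.Free.chooseBasis R N
  rw [← LinearMap.det_toMatrix (b.linearMap c), toMatrix_compRight_comp_lcomp,
    Matrix.det_kronecker, Matrix.det_transpose, LinearMap.det_toMatrix, LinearMap.det_toMatrix,
    finrank_eq_card_basis b, finrank_eq_card_basis c]

variable {𝕜 E F : Type*} [NontriviallyNormedField 𝕜]
  [NormedAddCommGroup E] [NormedSpace 𝕜 E] [NormedAddCommGroup F] [NormedSpace 𝕜 F]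

/-- The operator `Y ↦ g ∘ Y ∘ f` on the space of continuous linear maps. -/
def sandwich (f : E →L[𝕜] E) (g : F →L[𝕜] F) : (E →L[𝕜] F) →L[𝕜] (E →L[𝕜] F) :=
  g.postcomp E ∘L f.precomp F

theorem sandwich_apply (f : E →L[𝕜] E) (g : F →L[𝕜] F) (Y : E →L[𝕜] F) :
    sandwich f g Y = g ∘L Y ∘L f := rfl

theorem sandwich_image_closedBall_subset {f : E →L[𝕜] E} {g : F →L[𝕜] F} (hf : ‖f‖ ≤ 1)
    (hg : ‖g‖ ≤ 1) (δ : ℝ) : sandwich f g '' closedBall 0 δ ⊆ closedBall 0 δ := by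
  rintro _ ⟨Y, hY, rfl⟩
  rw [mem_closedBall_zero_iff] at hY ⊢
  calc ‖g ∘L Y ∘L f‖ ≤ ‖g‖ * (‖Y‖ * ‖f‖) := (g.opNorm_comp_le _).trans <| by
        gcongr
        exact Y.opNorm_comp_le f
    _ ≤ 1 * (‖Y‖ * 1) := by gcongr
    _ ≤ δ := by rwa [one_mul, mul_one]

variable [CompleteSpace 𝕜] [FiniteDimensional 𝕜 E] [FiniteDimensional 𝕜 F]

theorem finrank_continuousLinearMap :
    finrank 𝕜 (E →L[𝕜] F) = finrank 𝕜 E * finrank 𝕜 F := by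
  rw [← (LinearMap.toContinuousLinearMap (𝕜 := 𝕜) (E := E) (F' := F)).finrank_eq,
    finrank_linearMap]

theorem det_sandwich (f : E →L[𝕜] E) (g : F →L[𝕜] F) :
    (sandwich f g).det = g.det ^ finrank 𝕜 E * f.det ^ finrank 𝕜 F := by
  rw [ContinuousLinearMap.det, ← LinearMap.det_conj _ LinearMap.toContinuousLinearMap.symm]
  exact det_compRight_comp_lcomp f.toLinearMap g.toLinearMap

theorem pow_finrank_le_abs_det {F : Type*} [NormedAddCommGroup F] [NormedSpace ℝ F]
    [FiniteDimensional ℝ F] (f : F →ₗ[ℝ] F) {c : ℝ} (hc : 0 < c)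
    (hf : ∀ x, c * ‖x‖ ≤ ‖f x‖) : c ^ finrank ℝ F ≤ |LinearMap.det f| := by
  borelize F
  let μ : Measure F := Measure.addHaar
  have hinj : Function.Injective f := (injective_iff_map_eq_zero f).2 fun x hx => by
    have h := hf x
    rw [hx, norm_zero] at h
    exact norm_le_zero_iff.1 (nonpos_of_mul_nonpos_right h hc)
  have hsub : closedBall 0 c ⊆ f '' closedBall 0 1 := fun y hy => by
    obtain ⟨x, rfl⟩ := LinearMap.injective_iff_surjective.1 hinj y
    refine ⟨x, ?_, rfl⟩
    rw [mem_closedBall_zero_iff] at hy ⊢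
    exact le_of_mul_le_mul_left (by linarith [hf x]) hc
  have hvol := measure_mono (μ := μ) hsub
  rw [Measure.addHaar_image_linearMap, Measure.addHaar_closedBall' μ _ hc.le,
    ENNReal.mul_le_mul_iff_left (measure_closedBall_pos μ (0 : F) one_pos).ne'
      measure_closedBall_lt_top.ne] at hvol
  exact (ENNReal.ofReal_le_ofReal_iff (abs_nonneg _)).1 hvol

end Determinants

section OrthogonalGraph

variable {𝕜 E G : Type*} [RCLike 𝕜] [NormedAddCommGroup E] [InnerProductSpace 𝕜 E]
  [NormedAddCommGroup G] [NormedSpace 𝕜 G] {V : Submodule 𝕜 E}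

/-- The subspace of all `v + X v` with `v ∈ V`: the graph of `X : V → Vᗮ`, placed in the ambient
space along the decomposition `V ⊕ Vᗮ`. -/
def orthogonalGraph (X : V →L[𝕜] Vᗮ) : Submodule 𝕜 E :=
  LinearMap.range (V.subtypeL + Vᗮ.subtypeL ∘L X).toLinearMap

theorem mem_orthogonalGraph {X : V →L[𝕜] Vᗮ} {x : E} :
    x ∈ orthogonalGraph X ↔ ∃ v : V, (v : E) + X v = x := Iff.rfl

theorem starProjection_coe_add_coe [V.HasOrthogonalProjection] (v : V) (w : Vᗮ) :
    V.starProjection ((v : E) + w) = v :=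
  Submodule.eq_starProjection_of_mem_orthogonal' v.2 w.2 rfl

theorem norm_le_norm_coe_add_coe [V.HasOrthogonalProjection] (v : V) (w : Vᗮ) :
    ‖v‖ ≤ ‖(v : E) + w‖ := by
  have h := V.norm_starProjection_apply_le ((v : E) + w)
  rwa [starProjection_coe_add_coe] at h

theorem starProjection_orthogonal_coe_add_coe [V.HasOrthogonalProjection] (v : V) (w : Vᗮ) :
    Vᗮ.starProjection ((v : E) + w) = w := by
  rw [Submodule.starProjection_orthogonal_val, starProjection_coe_add_coe, add_sub_cancel_left]

theorem norm_le_norm_coe_add_coe' [V.HasOrthogonalProjection] (v : V) (w : Vᗮ) :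
    ‖w‖ ≤ ‖(v : E) + w‖ := by
  have h := Vᗮ.norm_starProjection_apply_le ((v : E) + w)
  rwa [starProjection_orthogonal_coe_add_coe] at h

theorem finrank_orthogonalGraph [V.HasOrthogonalProjection] (X : V →L[𝕜] Vᗮ) :
    finrank 𝕜 (orthogonalGraph X) = finrank 𝕜 V := by
  refine LinearMap.finrank_range_of_inj ((injective_iff_map_eq_zero _).2 fun v hv => ?_)
  have h := norm_le_norm_coe_add_coe v (X v)
  change (v : E) + X v = 0 at hv
  rwa [hv, norm_zero, norm_le_zero_iff] at h

variable [CompleteSpace E] [CompleteSpace V]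

theorem exists_coe_sub_adjoint_eq {X : V →L[𝕜] Vᗮ} {y : E} (hy : y ∈ (orthogonalGraph X)ᗮ) :
    ∃ w : Vᗮ, (w : E) - (X.adjoint w : E) = y := by
  let a : V := V.orthogonalProjectionOnto y
  let b : Vᗮ := ⟨y - a, Submodule.sub_starProjection_mem_orthogonal y⟩
  have hab : (a : E) + b = y := add_sub_cancel _ _
  suffices ha : a = -X.adjoint b from
    ⟨b, by rw [← hab, ha, Submodule.coe_neg, sub_eq_add_neg, add_comm]⟩
  refine ext_inner_left 𝕜 fun v => ?_
  have h := (Submodule.mem_orthogonal _ _).1 hy _ (mem_orthogonalGraph.2 ⟨v, rfl⟩)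
  rw [← hab, inner_add_left, inner_add_right, inner_add_right,
    Submodule.inner_right_of_mem_orthogonal v.2 b.2,
    Submodule.inner_left_of_mem_orthogonal a.2 (X v).2, add_zero, zero_add,
    ← Submodule.coe_inner, ← Submodule.coe_inner] at h
  rw [inner_neg_right, ContinuousLinearMap.adjoint_inner_right]
  exact eq_neg_of_add_eq_zero_left h

theorem norm_comp_starProjection_sub_le (A : E →L[𝕜] G) (X : V →L[𝕜] Vᗮ)
    [(orthogonalGraph X).HasOrthogonalProjection] :
    ‖A ∘L (V.starProjection - (orthogonalGraph X).starProjection)‖ ≤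
      ‖A ∘L Vᗮ.subtypeL ∘L X‖ + ‖A ∘L V.subtypeL ∘L X.adjoint‖ := by
  refine ContinuousLinearMap.opNorm_le_bound _ (by positivity) fun x => ?_
  set W := orthogonalGraph X
  obtain ⟨v, hv⟩ := mem_orthogonalGraph.1 (W.starProjection_apply_mem x)
  obtain ⟨w, hw⟩ := exists_coe_sub_adjoint_eq (W.sub_starProjection_mem_orthogonal x)
  have hw' : ((-X.adjoint w : V) : E) + w = x - W.starProjection x := by
    rw [← hw, Submodule.coe_neg]
    abel
  have hvx : ‖v‖ ≤ ‖x‖ := (norm_le_norm_coe_add_coe v (X v)).trans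
    (hv ▸ W.norm_starProjection_apply_le x)
  have hwx : ‖w‖ ≤ ‖x‖ := (norm_le_norm_coe_add_coe' (-X.adjoint w) w).trans <| by
    rw [hw', ← Submodule.starProjection_orthogonal_val]
    exact Wᗮ.norm_starProjection_apply_le x
  have hVx : V.starProjection x = v + ((-X.adjoint w : V) : E) := by
    rw [← add_sub_cancel (W.starProjection x) x, map_add, ← hv, starProjection_coe_add_coe,
      hv, ← hw', starProjection_coe_add_coe]
  have hdiff : V.starProjection x - W.starProjection x = -((X v : E) + X.adjoint w) := by
    rw [hVx, ← hv, Submodule.coe_neg]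
    abel
  calc ‖A (V.starProjection x - W.starProjection x)‖
      ≤ ‖(A ∘L Vᗮ.subtypeL ∘L X) v‖ + ‖(A ∘L V.subtypeL ∘L X.adjoint) w‖ := by
        rw [hdiff, map_neg, norm_neg, map_add]
        exact norm_add_le _ _
    _ ≤ ‖A ∘L Vᗮ.subtypeL ∘L X‖ * ‖x‖ + ‖A ∘L V.subtypeL ∘L X.adjoint‖ * ‖x‖ :=
        add_le_add (ContinuousLinearMap.le_opNorm_of_le _ hvx)
          (ContinuousLinearMap.le_opNorm_of_le _ hwx)
    _ = _ := (add_mul _ _ _).symm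

end OrthogonalGraph

section UniformMeasure

theorem abs_det_linearIsometry {F : Type*} [NormedAddCommGroup F] [NormedSpace ℝ F]
    [FiniteDimensional ℝ F] (e : F ≃ₗᵢ[ℝ] F) :
    |LinearMap.det (e.toLinearEquiv : F →ₗ[ℝ] F)| = 1 := by
  have hge : ∀ e : F ≃ₗᵢ[ℝ] F, 1 ≤ |LinearMap.det (e.toLinearEquiv : F →ₗ[ℝ] F)| := fun e => by
    have h := pow_finrank_le_abs_det (e.toLinearEquiv : F →ₗ[ℝ] F) one_pos fun x => by simp
    rwa [one_pow] at h
  have hmul : |LinearMap.det (e.toLinearEquiv : F →ₗ[ℝ] F)| *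
      |LinearMap.det (e.symm.toLinearEquiv : F →ₗ[ℝ] F)| = 1 := by
    rw [← abs_mul]
    exact congrArg abs e.toLinearEquiv.det_mul_det_symm |>.trans abs_one
  exact le_antisymm (hmul ▸ le_mul_of_one_le_right (abs_nonneg _) (hge e.symm)) (hge e)

theorem addHaar_preimage_linearIsometry {F : Type*} [NormedAddCommGroup F] [NormedSpace ℝ F]
    [FiniteDimensional ℝ F] [MeasurableSpace F] [BorelSpace F] (ν : Measure F) [ν.IsAddHaarMeasure]
    (f : F →ₗᵢ[ℝ] F) (s : Set F) : ν (f ⁻¹' s) = ν s := by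
  have hdet := abs_det_linearIsometry (f.toLinearIsometryEquiv rfl)
  have h := Measure.addHaar_preimage_linearMap ν (f := f.toLinearMap)
    (abs_pos.1 (hdet.symm ▸ one_pos)) s
  have hinv : |(LinearMap.det f.toLinearMap)⁻¹| = 1 := by
    rw [abs_inv, ← inv_one]
    exact congrArg _ hdet
  rwa [hinv, ENNReal.ofReal_one, one_mul] at h

variable {d r m : ℕ}

instance isProbabilityMeasure_haarO : IsProbabilityMeasure (haarO d) :=
  ⟨Measure.haarMeasure_self⟩

instance isMulRightInvariant_haarO : (haarO d).IsMulRightInvariant := by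
  have : (haarO d).IsHaarMeasure := inferInstanceAs (Measure.haarMeasure ⊤).IsHaarMeasure
  refine ⟨fun R => ?_⟩
  have : IsProbabilityMeasure ((haarO d).map (· * R)) :=
    Measure.isProbabilityMeasure_map (measurable_mul_const R).aemeasurable
  exact Measure.isHaarMeasure_eq_of_isProbabilityMeasure _ _

instance isProbabilityMeasure_uniformGr (hr : r ≤ d) : IsProbabilityMeasure (uniformGr hr) :=
  ⟨uniformGr_univ hr⟩

theorem exists_rotate_eq (V W : Gr d r) : ∃ R : OGroup d, rotate R V = W := by
  let e : V.1 ≃ₗᵢ[ℝ] W.1 := (stdOrthonormalBasis ℝ V.1).equiv (stdOrthonormalBasis ℝ W.1)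
    (finCongr (V.2.trans W.2.symm))
  let f : V.1 →ₗᵢ[ℝ] Euc d := W.1.subtypeₗᵢ.comp e.toLinearIsometry
  let g : Euc d ≃ₗᵢ[ℝ] Euc d := f.extend.toLinearIsometryEquiv rfl
  have hg : ∀ x : V.1, g x = e x := f.extend_apply
  refine ⟨Unitary.linearIsometryEquiv.symm g, Subtype.ext ?_⟩
  change V.1.map (Unitary.linearIsometryEquiv _).toLinearEquiv.toLinearMap = W.1
  rw [MulEquiv.apply_symm_apply]
  refine le_antisymm (Submodule.map_le_iff_le_comap.2 fun x hx => ?_) fun y hy => ?_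
  · change g x ∈ W.1
    exact hg ⟨x, hx⟩ ▸ (e _).2
  · refine ⟨e.symm ⟨y, hy⟩, (e.symm ⟨y, hy⟩).2, ?_⟩
    change g _ = y
    rw [hg, e.apply_symm_apply]

theorem uniformGr_eq_map (hr : r ≤ d) (V : Gr d r) :
    uniformGr hr = (haarO d).map fun U => rotate U V := by
  obtain ⟨R, rfl⟩ := exists_rotate_eq (coordSubspace hr) V
  have hmul : (fun U => rotate U (rotate R (coordSubspace hr))) =
      (fun U => rotate U (coordSubspace hr)) ∘ (· * R) :=
    funext fun U => (rotate_mul U R _).symm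
  rw [hmul, ← Measure.map_map (measurable_rotate _) (measurable_mul_const R),
    map_mul_right_eq_self, uniformGr]

variable {F : Type*} [NormedAddCommGroup F] [NormedSpace ℝ F]

theorem haarO_setOf_comp_mem_le (hr : r ≤ d) {B : Set (Gr d r)} {s : Set (F →L[ℝ] Euc d)}
    (hB : ∀ M ∈ s, ∃ W ∈ B, W.1 = LinearMap.range M.toLinearMap) (M : F →L[ℝ] Euc d) :
    haarO d {U | (U : Euc d →L[ℝ] Euc d) ∘L M ∈ s} ≤ uniformGr hr B := by
  rcases Set.eq_empty_or_nonempty {U : OGroup d | (U : Euc d →L[ℝ] Euc d) ∘L M ∈ s} with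
    hempty | ⟨U₀, hU₀⟩
  · rw [hempty, measure_empty]
    exact zero_le
  have hrange : ∀ U : OGroup d, (U : Euc d →L[ℝ] Euc d) ∘L M ∈ s → ∃ W ∈ B,
      W.1 = (LinearMap.range M.toLinearMap).map
        (Unitary.linearIsometryEquiv U).toLinearEquiv.toLinearMap := fun U hU => by
    rw [← LinearMap.range_comp]
    exact hB _ hU
  obtain ⟨W₀, -, hW₀⟩ := hrange U₀ hU₀
  let W : Gr d r := ⟨LinearMap.range M.toLinearMap, by
    rw [← W₀.2, hW₀, LinearEquiv.finrank_map_eq]⟩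
  rw [uniformGr_eq_map hr W]
  refine (measure_mono fun U hU => ?_).trans
    (Measure.le_map_apply (measurable_rotate W).aemeasurable B)
  obtain ⟨W', hW'B, hW'⟩ := hrange U hU
  have hrot : rotate U W = W' := Subtype.ext hW'.symm
  change rotate U W ∈ B
  rwa [hrot]

theorem addHaar_le_uniformGr_mul [FiniteDimensional ℝ F] (ν : Measure (F →L[ℝ] Euc d))
    [ν.IsAddHaarMeasure] (hr : r ≤ d) {B : Set (Gr d r)} {s : Set (F →L[ℝ] Euc d)}
    (hs : MeasurableSet s) (hs_ball : s ⊆ closedBall 0 1)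
    (hB : ∀ M ∈ s, ∃ W ∈ B, W.1 = LinearMap.range M.toLinearMap) :
    ν s ≤ uniformGr hr B * ν (closedBall 0 1) := by
  let act (U : OGroup d) : (F →L[ℝ] Euc d) →ₗᵢ[ℝ] (F →L[ℝ] Euc d) :=
    (Unitary.linearIsometryEquiv U).toLinearIsometry.postcomp
  let t : Set (OGroup d × (F →L[ℝ] Euc d)) := {p | (p.1 : Euc d →L[ℝ] Euc d) ∘L p.2 ∈ s}
  have ht : MeasurableSet t :=
    (show Continuous fun p : OGroup d × (F →L[ℝ] Euc d) =>
      (p.1 : Euc d →L[ℝ] Euc d) ∘L p.2 by fun_prop).measurable hs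
  have hfiber : ∀ M, haarO d ((fun U => (U, M)) ⁻¹' t) ≤
      (closedBall 0 1).indicator (fun _ => uniformGr hr B) M := fun M => by
    by_cases hM : M ∈ closedBall 0 1
    · rw [Set.indicator_of_mem hM]
      exact haarO_setOf_comp_mem_le hr hB M
    · have hempty : (fun U => (U, M)) ⁻¹' t = ∅ :=
        Set.eq_empty_of_forall_notMem fun U hU => hM <| by
          rw [mem_closedBall_zero_iff, ← (act U).norm_map M]
          exact mem_closedBall_zero_iff.1 (hs_ball hU)
      rw [hempty, measure_empty]
      exact zero_le
  calc ν s = ∫⁻ U, ν (act U ⁻¹' s) ∂haarO d := by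
        simp_rw [addHaar_preimage_linearIsometry, lintegral_const, measure_univ, mul_one]
    _ = ((haarO d).prod ν) t := (Measure.prod_apply ht).symm
    _ = ∫⁻ M, haarO d ((fun U => (U, M)) ⁻¹' t) ∂ν := Measure.prod_apply_symm ht
    _ ≤ ∫⁻ M, (closedBall 0 1).indicator (fun _ => uniformGr hr B) M ∂ν := lintegral_mono hfiber
    _ = uniformGr hr B * ν (closedBall 0 1) :=
        lintegral_indicator_const isClosed_closedBall.measurableSet _

/-- The orthogonal complement, as a map between Grassmannians. -/
def compl (hd : r + m = d) (V : Gr d r) : Gr d m :=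
  ⟨V.1ᗮ, Submodule.finrank_add_finrank_orthogonal' (by rw [V.2, hd, finrank_euclideanSpace_fin])⟩

theorem proj_compl (hd : r + m = d) (V : Gr d r) : proj (compl hd V) = 1 - proj V :=
  Submodule.starProjection_orthogonal' V.1

theorem proj_injective : Function.Injective (proj (d := d) (r := r)) := fun _ _ h =>
  Subtype.ext (Submodule.starProjection_inj.1 h)

theorem rotate_compl (hd : r + m = d) (U : OGroup d) (V : Gr d r) :
    rotate U (compl hd V) = compl hd (rotate U V) := by
  refine proj_injective ?_
  rw [proj_rotate, proj_compl, proj_compl, proj_rotate, mul_sub, sub_mul, mul_one,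
    Unitary.mul_star_self_of_mem U.2]

theorem measurable_compl (hd : r + m = d) : Measurable (compl hd) := by
  refine measurable_comap_iff.mpr ?_
  have h : proj ∘ compl hd = (fun P => 1 - P) ∘ proj := funext (proj_compl hd)
  rw [h]
  exact (measurable_const.sub measurable_id).comp (comap_measurable _)

theorem uniformGr_map_compl (hd : r + m = d) :
    (uniformGr (Nat.le.intro hd)).map (compl hd) =
      uniformGr (Nat.le.intro ((add_comm m r).trans hd)) := by
  have hcomp : compl hd ∘ (fun U => rotate U (coordSubspace (Nat.le.intro hd))) =
      fun U => rotate U (compl hd (coordSubspace (Nat.le.intro hd))) :=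
    funext fun U => (rotate_compl hd U _).symm
  rw [uniformGr, Measure.map_map (measurable_compl hd) (measurable_rotate _), hcomp,
    ← uniformGr_eq_map]

end UniformMeasure

section Volume

theorem ofReal_mul_le_prod_of_le_abs_det {Ω F : Type*} [MeasurableSpace Ω]
    [NormedAddCommGroup F] [NormedSpace ℝ F] [FiniteDimensional ℝ F] [MeasurableSpace F]
    [BorelSpace F] (μ : Measure Ω) (ν : Measure F) [ν.IsAddHaarMeasure] {K : Set Ω}
    (hK : MeasurableSet K) {s : Set F} {t : Set (Ω × F)} (ht : MeasurableSet t)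
    (T : Ω → F →L[ℝ] F) {c : ℝ} (hc : ∀ x ∈ K, c ≤ |(T x).det|)
    (hT : ∀ x ∈ K, ∀ y ∈ s, (x, T x y) ∈ t) :
    ENNReal.ofReal c * ν s * μ K ≤ (μ.prod ν) t := by
  rw [Measure.prod_apply ht, ← setLIntegral_const]
  refine (setLIntegral_mono' hK fun x hx => ?_).trans (setLIntegral_le_lintegral K _)
  calc ENNReal.ofReal c * ν s ≤ ENNReal.ofReal |(T x).det| * ν s := by
        gcongr
        exact hc x hx
    _ = ν (T x '' s) := (Measure.addHaar_image_continuousLinearMap ν (T x) s).symm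
    _ ≤ ν (Prod.mk x ⁻¹' t) := measure_mono (Set.image_subset_iff.2 (hT x hx))

section HomSplit

variable {𝕜 E : Type*} [RCLike 𝕜] [NormedAddCommGroup E] [InnerProductSpace 𝕜 E]
  (F : Type*) [NormedAddCommGroup F] [NormedSpace 𝕜 F]
  (V : Submodule 𝕜 E) [V.HasOrthogonalProjection]

/-- The decomposition of linear maps `F → E` into their components along `V` and `Vᗮ`. -/
def homSplit : ((F →L[𝕜] V) × (F →L[𝕜] Vᗮ)) ≃L[𝕜] (F →L[𝕜] E) :=
  ContinuousLinearEquiv.equivOfInverse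
    ((V.subtypeL.postcomp F).coprod (Vᗮ.subtypeL.postcomp F))
    ((V.orthogonalProjectionOnto.postcomp F).prod (Vᗮ.orthogonalProjectionOnto.postcomp F))
    (fun M => Prod.ext
      (ContinuousLinearMap.ext fun x => Subtype.ext (starProjection_coe_add_coe (M.1 x) (M.2 x)))
      (ContinuousLinearMap.ext fun x => Subtype.ext
        (starProjection_orthogonal_coe_add_coe (M.1 x) (M.2 x))))
    (fun N => ContinuousLinearMap.ext fun x => by
      change V.starProjection (N x) + Vᗮ.starProjection (N x) = N x
      rw [Submodule.starProjection_orthogonal_val, add_sub_cancel])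

variable {F V}

theorem homSplit_apply (M : (F →L[𝕜] V) × (F →L[𝕜] Vᗮ)) :
    homSplit F V M = V.subtypeL ∘L M.1 + Vᗮ.subtypeL ∘L M.2 := rfl

theorem norm_le_norm_homSplit (M : (F →L[𝕜] V) × (F →L[𝕜] Vᗮ)) : ‖M‖ ≤ ‖homSplit F V M‖ :=
  max_le
    (ContinuousLinearMap.opNorm_le_bound _ (norm_nonneg _) fun x =>
      (norm_le_norm_coe_add_coe (M.1 x) (M.2 x)).trans ((homSplit F V M).le_opNorm x))
    (ContinuousLinearMap.opNorm_le_bound _ (norm_nonneg _) fun x =>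
      (norm_le_norm_coe_add_coe' (M.1 x) (M.2 x)).trans ((homSplit F V M).le_opNorm x))

theorem norm_homSplit_le (M : (F →L[𝕜] V) × (F →L[𝕜] Vᗮ)) :
    ‖homSplit F V M‖ ≤ ‖M.1‖ + ‖M.2‖ := by
  rw [homSplit_apply]
  exact (norm_add_le _ _).trans (add_le_add (V.subtypeₗᵢ.norm_toContinuousLinearMap_comp).le
    (Vᗮ.subtypeₗᵢ.norm_toContinuousLinearMap_comp).le)

theorem range_homSplit_comp (X : V →L[𝕜] Vᗮ) {M : F →L[𝕜] V} (hM : Function.Surjective M) :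
    LinearMap.range (homSplit F V (M, X ∘L M)).toLinearMap = orthogonalGraph X :=
  LinearMap.range_comp_of_range_eq_top (V.subtypeL + Vᗮ.subtypeL ∘L X).toLinearMap
    (LinearMap.range_eq_top.2 hM)

end HomSplit

section NearScaledIdentity

variable {F : Type*} [NormedAddCommGroup F] [NormedSpace ℝ F] {M : F →L[ℝ] F}

theorem mul_norm_le_of_mem_closedBall {a b : ℝ} (hM : M ∈ closedBall (a • (1 : F →L[ℝ] F)) b)
    (x : F) : (a - b) * ‖x‖ ≤ ‖M x‖ := by
  have h : ‖M x - a • x‖ ≤ b * ‖x‖ :=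
    ContinuousLinearMap.le_of_opNorm_le _ (mem_closedBall_iff_norm.1 hM) x
  have h' : a * ‖x‖ ≤ ‖a • x‖ := by
    rw [norm_smul]
    exact mul_le_mul_of_nonneg_right (le_abs_self a) (norm_nonneg x)
  linarith [norm_le_norm_add_norm_sub (M x) (a • x)]

theorem surjective_of_mem_closedBall [FiniteDimensional ℝ F] {a b : ℝ} (hab : b < a)
    (hM : M ∈ closedBall (a • (1 : F →L[ℝ] F)) b) : Function.Surjective M := by
  have hinj : Function.Injective M := (injective_iff_map_eq_zero M).2 fun x hx => by
    have h := mul_norm_le_of_mem_closedBall hM x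
    rw [hx, norm_zero] at h
    exact norm_le_zero_iff.1 (nonpos_of_mul_nonpos_right h (sub_pos.2 hab))
  exact LinearMap.injective_iff_surjective.1 hinj

theorem norm_le_of_mem_closedBall_smul_one {a b : ℝ} (ha : 0 ≤ a)
    (hM : M ∈ closedBall (a • (1 : F →L[ℝ] F)) b) : ‖M‖ ≤ a + b := by
  have hone : ‖a • (1 : F →L[ℝ] F)‖ ≤ a := by
    rw [norm_smul, Real.norm_of_nonneg ha]
    exact mul_le_of_le_one_right ha ContinuousLinearMap.norm_id_le
  have hsub := mem_closedBall_iff_norm.1 hM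
  linarith [norm_le_norm_add_norm_sub' M (a • (1 : F →L[ℝ] F))]

end NearScaledIdentity

section GraphPairs

variable {P Q : Type*} [NormedAddCommGroup P] [NormedSpace ℝ P]
  [NormedAddCommGroup Q] [NormedSpace ℝ Q]

/-- The pairs `(M, X ∘ M)` with `X ∈ s` and `M` within `1/8` of `1/4`: parametrizations of the
graphs of the maps in `s`. The constants make every such `M` invertible and of norm at
most `1/2`. -/
def graphPairs (s : Set (P →L[ℝ] Q)) : Set ((P →L[ℝ] P) × (P →L[ℝ] Q)) :=
  (fun p : (P →L[ℝ] P) × (P →L[ℝ] Q) => (p.1, p.2 ∘L p.1)) ''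
    (closedBall ((1 / 4 : ℝ) • 1) (1 / 8) ×ˢ s)

theorem norm_add_norm_le_one_of_mem_graphPairs {s : Set (P →L[ℝ] Q)} (hs : s ⊆ closedBall 0 1)
    {M : (P →L[ℝ] P) × (P →L[ℝ] Q)} (hM : M ∈ graphPairs s) : ‖M.1‖ + ‖M.2‖ ≤ 1 := by
  obtain ⟨⟨M, X⟩, ⟨hMK, hX⟩, rfl⟩ := hM
  have hM₁ : ‖M‖ ≤ 1 / 4 + 1 / 8 := norm_le_of_mem_closedBall_smul_one (by norm_num) hMK
  have hM₂ : ‖X ∘L M‖ ≤ ‖M‖ := (X.opNorm_comp_le M).trans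
    (mul_le_of_le_one_left (norm_nonneg M) (mem_closedBall_zero_iff.1 (hs hX)))
  change ‖M‖ + ‖X ∘L M‖ ≤ 1
  linarith

theorem surjective_of_mem_graphPairs [FiniteDimensional ℝ P] {s : Set (P →L[ℝ] Q)}
    {M : (P →L[ℝ] P) × (P →L[ℝ] Q)} (hM : M ∈ graphPairs s) :
    Function.Surjective M.1 ∧ ∃ X ∈ s, M.2 = X ∘L M.1 := by
  obtain ⟨⟨M, X⟩, ⟨hMK, hX⟩, rfl⟩ := hM
  exact ⟨surjective_of_mem_closedBall (by norm_num) hMK, X, hX, rfl⟩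

theorem isCompact_graphPairs [FiniteDimensional ℝ P] {s : Set (P →L[ℝ] Q)} (hs : IsCompact s) :
    IsCompact (graphPairs s) :=
  ((isCompact_closedBall _ _).prod hs).image (by fun_prop)

variable [FiniteDimensional ℝ P] [FiniteDimensional ℝ Q]

theorem mul_le_prod_graphPairs (ρ : Measure (P →L[ℝ] P)) [ρ.IsAddHaarMeasure]
    (μ : Measure (P →L[ℝ] Q)) [μ.IsAddHaarMeasure] {s : Set (P →L[ℝ] Q)} (hs : IsCompact s) :
    ENNReal.ofReal ((1 / 8) ^ (finrank ℝ P * (finrank ℝ P + finrank ℝ Q))) * μ s *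
      ρ (closedBall 0 1) ≤ (ρ.prod μ) (graphPairs s) := by
  have hdet : ∀ M ∈ closedBall ((1 / 4 : ℝ) • (1 : P →L[ℝ] P)) (1 / 8),
      (1 / 8 : ℝ) ^ (finrank ℝ P * finrank ℝ Q) ≤
        |(sandwich M (1 : Q →L[ℝ] Q)).det| := fun M hM => by
    have h := pow_finrank_le_abs_det M.toLinearMap (by norm_num) (mul_norm_le_of_mem_closedBall hM)
    have hone : (1 : Q →L[ℝ] Q).det = 1 := LinearMap.det_id
    rw [det_sandwich, hone, one_pow, one_mul, abs_pow, pow_mul]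
    rw [show (1 / 4 - 1 / 8 : ℝ) = 1 / 8 by norm_num] at h
    exact pow_le_pow_left₀ (by positivity) h _
  have hprod := ofReal_mul_le_prod_of_le_abs_det ρ μ isClosed_closedBall.measurableSet
    (isCompact_graphPairs hs).measurableSet (fun M => sandwich M 1) hdet
    (fun M hM X hX => ⟨(M, X), ⟨hM, hX⟩, rfl⟩)
  rw [Measure.addHaar_closedBall' ρ _ (by norm_num), finrank_continuousLinearMap] at hprod
  refine le_of_eq_of_le ?_ hprod
  rw [mul_add, pow_add, ENNReal.ofReal_mul (by positivity)]
  ring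

end GraphPairs

section Grassmannian

variable {d r m : ℕ}

theorem prod_le_uniformGr_mul (hr : r ≤ d) {G H F : Type*}
    [NormedAddCommGroup G] [NormedSpace ℝ G] [FiniteDimensional ℝ G] [MeasurableSpace G]
    [BorelSpace G] [NormedAddCommGroup H] [NormedSpace ℝ H] [FiniteDimensional ℝ H]
    [MeasurableSpace H] [BorelSpace H] [NormedAddCommGroup F] [NormedSpace ℝ F]
    [FiniteDimensional ℝ F] (e : (G × H) ≃L[ℝ] (F →L[ℝ] Euc d)) (he : ∀ M, ‖M‖ ≤ ‖e M‖)
    (ρ : Measure G) [ρ.IsAddHaarMeasure] (μ : Measure H) [μ.IsAddHaarMeasure] {B : Set (Gr d r)}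
    {t : Set (G × H)} (ht : IsCompact t) (ht_norm : ∀ M ∈ t, ‖e M‖ ≤ 1)
    (hB : ∀ M ∈ t, ∃ W ∈ B, W.1 = LinearMap.range (e M).toLinearMap) :
    (ρ.prod μ) t ≤ uniformGr hr B * (ρ (closedBall 0 1) * μ (closedBall 0 1)) := by
  let ν : Measure (F →L[ℝ] Euc d) := (ρ.prod μ).map e
  have : ν.IsAddHaarMeasure := e.isAddHaarMeasure_map _
  have het : MeasurableSet (e '' t) := (ht.image e.continuous).measurableSet
  have hball : ν (closedBall 0 1) ≤ ρ (closedBall 0 1) * μ (closedBall 0 1) := by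
    rw [Measure.map_apply e.continuous.measurable isClosed_closedBall.measurableSet,
      ← Measure.prod_prod, closedBall_prod_same]
    refine measure_mono fun M hM => mem_closedBall_zero_iff.2 ?_
    exact (he M).trans (mem_closedBall_zero_iff.1 hM)
  calc (ρ.prod μ) t = ν (e '' t) := by
        rw [Measure.map_apply e.continuous.measurable het, Set.preimage_image_eq _ e.injective]
    _ ≤ uniformGr hr B * ν (closedBall 0 1) :=
        addHaar_le_uniformGr_mul ν hr het
          (Set.image_subset_iff.2 fun M hM => mem_closedBall_zero_iff.2 (ht_norm M hM))
          (Set.forall_mem_image.2 hB)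
    _ ≤ _ := by gcongr

theorem le_uniformGr_of_graphPairs (hr : r ≤ d) {P Q F : Type*}
    [NormedAddCommGroup P] [NormedSpace ℝ P] [FiniteDimensional ℝ P]
    [NormedAddCommGroup Q] [NormedSpace ℝ Q] [FiniteDimensional ℝ Q]
    [NormedAddCommGroup F] [NormedSpace ℝ F] [FiniteDimensional ℝ F]
    (e : ((P →L[ℝ] P) × (P →L[ℝ] Q)) ≃L[ℝ] (F →L[ℝ] Euc d)) (he : ∀ M, ‖M‖ ≤ ‖e M‖)
    (T : (P →L[ℝ] Q) →L[ℝ] (P →L[ℝ] Q)) {δ : ℝ} (hδ : 0 ≤ δ) {B : Set (Gr d r)}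
    (hT_norm : ∀ M ∈ graphPairs (T '' closedBall 0 δ), ‖e M‖ ≤ 1)
    (hB : ∀ M ∈ graphPairs (T '' closedBall 0 δ),
      ∃ W ∈ B, W.1 = LinearMap.range (e M).toLinearMap) :
    ENNReal.ofReal ((1 / 8) ^ (finrank ℝ P * (finrank ℝ P + finrank ℝ Q)) *
      (|T.det| * δ ^ (finrank ℝ P * finrank ℝ Q))) ≤ uniformGr hr B := by
  let ρ : Measure (P →L[ℝ] P) := Measure.addHaar
  let μ : Measure (P →L[ℝ] Q) := Measure.addHaar
  have hs : IsCompact (T '' closedBall 0 δ) := (isCompact_closedBall _ _).image T.continuous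
  have h := (mul_le_prod_graphPairs ρ μ hs).trans
    (prod_le_uniformGr_mul hr e he ρ μ (isCompact_graphPairs hs) hT_norm hB)
  rw [Measure.addHaar_image_continuousLinearMap, Measure.addHaar_closedBall' μ _ hδ,
    finrank_continuousLinearMap] at h
  have hρμ : ρ (closedBall 0 1) * μ (closedBall 0 1) ≠ 0 :=
    mul_ne_zero (measure_closedBall_pos ρ _ one_pos).ne' (measure_closedBall_pos μ _ one_pos).ne'
  have hρμ_top : ρ (closedBall 0 1) * μ (closedBall 0 1) ≠ ⊤ :=
    ENNReal.mul_ne_top measure_closedBall_lt_top.ne measure_closedBall_lt_top.ne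
  refine (ENNReal.mul_le_mul_iff_left hρμ hρμ_top).1 (le_of_eq_of_le ?_ h)
  rw [ENNReal.ofReal_mul (by positivity), ENNReal.ofReal_mul (abs_nonneg _)]
  ring

theorem le_uniformGr_of_orthogonalGraph (hd : r + m = d) {V : Submodule ℝ (Euc d)}
    (hV : finrank ℝ V = r) {D₁ : V →L[ℝ] V} {D₂ : Vᗮ →L[ℝ] Vᗮ} (hD₁ : ‖D₁‖ ≤ 1) (hD₂ : ‖D₂‖ ≤ 1)
    {δ : ℝ} (hδ₀ : 0 ≤ δ) (hδ₁ : δ ≤ 1) {B : Set (Gr d r)}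
    (hB : ∀ Y : V →L[ℝ] Vᗮ, ‖Y‖ ≤ δ → ∃ W ∈ B, W.1 = orthogonalGraph (D₂ ∘L Y ∘L D₁)) :
    ENNReal.ofReal ((1 / 8) ^ (r * d) *
      (|D₂.det| ^ r * |D₁.det| ^ m * δ ^ (r * m))) ≤ uniformGr (Nat.le.intro hd) B := by
  have hVo : finrank ℝ Vᗮ = m := (compl hd ⟨V, hV⟩).2
  have hs : sandwich D₁ D₂ '' closedBall 0 δ ⊆ closedBall 0 1 :=
    (sandwich_image_closedBall_subset hD₁ hD₂ δ).trans (closedBall_subset_closedBall hδ₁)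
  have h := le_uniformGr_of_graphPairs (Nat.le.intro hd) (homSplit V V) norm_le_norm_homSplit
    (sandwich D₁ D₂) hδ₀ (B := B)
    (fun M hM => (norm_homSplit_le M).trans (norm_add_norm_le_one_of_mem_graphPairs hs hM))
    (fun M hM => by
      obtain ⟨hM₁, X, ⟨Y, hY, rfl⟩, hM₂⟩ := surjective_of_mem_graphPairs hM
      obtain ⟨W, hWB, hW⟩ := hB Y ((mem_closedBall_zero_iff (a := Y)).1 hY)
      refine ⟨W, hWB, hW.trans ?_⟩
      rw [← sandwich_apply, ← range_homSplit_comp _ hM₁, ← hM₂])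
  rwa [hV, hVo, hd, det_sandwich, abs_mul, abs_pow, abs_pow, hV, hVo] at h

end Grassmannian

end Volume

section ProjectionBall

theorem norm_comp_starProjection_sub_orthogonalGraph_le {𝕜 E G : Type*} [RCLike 𝕜]
    [NormedAddCommGroup E] [InnerProductSpace 𝕜 E] [CompleteSpace E]
    [NormedAddCommGroup G] [NormedSpace 𝕜 G] {V : Submodule 𝕜 E} [CompleteSpace V]
    {A : E →L[𝕜] G} {D₁ : V →L[𝕜] V} {D₂ : Vᗮ →L[𝕜] Vᗮ}
    (hD₁ : IsSelfAdjoint D₁) (hD₂ : IsSelfAdjoint D₂) (hD₁_norm : ‖D₁‖ ≤ 1) (hD₂_norm : ‖D₂‖ ≤ 1)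
    {ε : ℝ} (hAD₁ : ‖A ∘L V.subtypeL ∘L D₁‖ ≤ ε) (hAD₂ : ‖A ∘L Vᗮ.subtypeL ∘L D₂‖ ≤ ε)
    {Y : V →L[𝕜] Vᗮ} (hY : ‖Y‖ ≤ 1 / 2)
    [(orthogonalGraph (D₂ ∘L Y ∘L D₁)).HasOrthogonalProjection] :
    ‖A ∘L (V.starProjection - (orthogonalGraph (D₂ ∘L Y ∘L D₁)).starProjection)‖ ≤ ε := by
  have hε : 0 ≤ ε := (norm_nonneg _).trans hAD₁
  have hadj : (D₂ ∘L Y ∘L D₁).adjoint = D₁ ∘L Y.adjoint ∘L D₂ := by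
    rw [ContinuousLinearMap.adjoint_comp, ContinuousLinearMap.adjoint_comp, hD₁.adjoint_eq,
      hD₂.adjoint_eq, ContinuousLinearMap.comp_assoc]
  have hX : ‖A ∘L Vᗮ.subtypeL ∘L D₂ ∘L Y ∘L D₁‖ ≤ ε / 2 :=
    calc ‖(A ∘L Vᗮ.subtypeL ∘L D₂) ∘L Y ∘L D₁‖
        ≤ ‖A ∘L Vᗮ.subtypeL ∘L D₂‖ * (‖Y‖ * ‖D₁‖) :=
          (ContinuousLinearMap.opNorm_comp_le _ _).trans (by gcongr; exact Y.opNorm_comp_le D₁)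
      _ ≤ ε * (1 / 2 * 1) := by gcongr
      _ = ε / 2 := by ring
  have hX' : ‖A ∘L V.subtypeL ∘L D₁ ∘L Y.adjoint ∘L D₂‖ ≤ ε / 2 :=
    calc ‖(A ∘L V.subtypeL ∘L D₁) ∘L Y.adjoint ∘L D₂‖
        ≤ ‖A ∘L V.subtypeL ∘L D₁‖ * (‖Y.adjoint‖ * ‖D₂‖) :=
          (ContinuousLinearMap.opNorm_comp_le _ _).trans
            (by gcongr; exact Y.adjoint.opNorm_comp_le D₂)
      _ ≤ ε * (1 / 2 * 1) := by
        rw [LinearIsometryEquiv.norm_map]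
        gcongr
      _ = ε / 2 := by ring
  refine (norm_comp_starProjection_sub_le A _).trans ?_
  rw [hadj]
  linarith

theorem exists_isSelfAdjoint_norm_comp_linearIsometry_le {E F G : Type*}
    [NormedAddCommGroup E] [InnerProductSpace ℝ E] [FiniteDimensional ℝ E]
    [NormedAddCommGroup F] [InnerProductSpace ℝ F] [FiniteDimensional ℝ F]
    [NormedAddCommGroup G] [InnerProductSpace ℝ G] [FiniteDimensional ℝ G]
    (A : E →L[ℝ] G) (J : F →ₗᵢ[ℝ] E) {ε : ℝ} (hε : 0 < ε) :
    ∃ D : F →L[ℝ] F, IsSelfAdjoint D ∧ ‖D‖ ≤ 1 ∧ ‖A ∘L J.toContinuousLinearMap ∘L D‖ ≤ ε ∧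
      contractionProduct ε A.toLinearMap.singularValues (finrank ℝ F) ≤ |D.det| := by
  obtain ⟨D, hD, hD_norm, hAD, hdet⟩ :=
    exists_isSymmetric_norm_comp_le (A ∘L J.toContinuousLinearMap) hε
  refine ⟨D, ContinuousLinearMap.isSelfAdjoint_iff_isSymmetric.2 hD, hD_norm, hAD, ?_⟩
  refine (contractionProduct_anti hε
    (singularValues_comp_linearIsometry_le A.toLinearMap J) _).trans ?_
  exact hdet.symm.le.trans (le_abs_self _)

variable {d r m : ℕ} {G : Type*} [NormedAddCommGroup G] [InnerProductSpace ℝ G]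

/-- The closed ball around `V` for the pseudometric `‖A (P_V - P_W)‖` on the Grassmannian, for an
arbitrary operator `A` in the place of `S^{1/2}`. -/
def projBall (A : Euc d →L[ℝ] G) (V : Gr d r) (ε : ℝ) : Set (Gr d r) :=
  {W | ‖A ∘L (proj V - proj W)‖ ≤ ε}

theorem measurableSet_projBall (A : Euc d →L[ℝ] G) (V : Gr d r) (ε : ℝ) :
    MeasurableSet (projBall A V ε) := by
  have hcont : Continuous fun P : Euc d →L[ℝ] Euc d => ‖A ∘L (proj V - P)‖ := by fun_prop
  exact (hcont.measurable.comp (comap_measurable _)) measurableSet_Iic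

theorem preimage_compl_projBall (hd : r + m = d) (A : Euc d →L[ℝ] G) (V : Gr d r) (ε : ℝ) :
    compl hd ⁻¹' projBall A (compl hd V) ε = projBall A V ε := by
  ext W
  change ‖A ∘L (proj (compl hd V) - proj (compl hd W))‖ ≤ ε ↔ ‖A ∘L (proj V - proj W)‖ ≤ ε
  rw [proj_compl, proj_compl, sub_sub_sub_cancel_left, ← neg_sub, ContinuousLinearMap.comp_neg,
    norm_neg]

variable [FiniteDimensional ℝ G]

theorem ofReal_le_uniformGr_projBall (hd : r + m = d) (A : Euc d →L[ℝ] G) (V : Gr d r) {ε : ℝ}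
    (hε : 0 < ε) :
    ENNReal.ofReal ((1 / 8) ^ (r * d) * (contractionProduct ε A.toLinearMap.singularValues m ^ r *
      contractionProduct ε A.toLinearMap.singularValues r ^ m * (1 / 2) ^ (r * m))) ≤
        uniformGr (Nat.le.intro hd) (projBall A V ε) := by
  obtain ⟨V, hV⟩ := V
  have hVo : finrank ℝ Vᗮ = m := (compl hd ⟨V, hV⟩).2
  obtain ⟨D₁, hD₁, hD₁_norm, hAD₁, hdet₁⟩ :=
    exists_isSelfAdjoint_norm_comp_linearIsometry_le A V.subtypeₗᵢ hε
  obtain ⟨D₂, hD₂, hD₂_norm, hAD₂, hdet₂⟩ :=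
    exists_isSelfAdjoint_norm_comp_linearIsometry_le A Vᗮ.subtypeₗᵢ hε
  rw [hV] at hdet₁
  rw [hVo] at hdet₂
  have hprod : ∀ n, 0 ≤ contractionProduct ε A.toLinearMap.singularValues n := fun n =>
    (contractionProduct_pos hε _ n).le
  refine le_trans (ENNReal.ofReal_le_ofReal ?_) (le_uniformGr_of_orthogonalGraph hd hV hD₁_norm
    hD₂_norm one_half_pos.le one_half_lt_one.le fun Y hY => ?_)
  · have hpow := mul_le_mul (pow_le_pow_left₀ (hprod m) hdet₂ r)
      (pow_le_pow_left₀ (hprod r) hdet₁ m) (pow_nonneg (hprod r) m) (by positivity)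
    gcongr
  · exact ⟨⟨orthogonalGraph (D₂ ∘L Y ∘L D₁), (finrank_orthogonalGraph _).trans hV⟩,
      norm_comp_starProjection_sub_orthogonalGraph_le hD₁ hD₂ hD₁_norm hD₂_norm hAD₁ hAD₂ hY, rfl⟩

theorem ofReal_le_uniformGr_projBall_of_le (hd : r + m = d) (hrm : r ≤ m) (A : Euc d →L[ℝ] G)
    (V : Gr d r) {ε : ℝ} (hε : 0 < ε) :
    ENNReal.ofReal ((1 / 128) ^ (r * m) *
      (contractionProduct ε A.toLinearMap.singularValues m ^ r *
        contractionProduct ε A.toLinearMap.singularValues r ^ m)) ≤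
          uniformGr (Nat.le.intro hd) (projBall A V ε) := by
  refine le_trans (ENNReal.ofReal_le_ofReal ?_) (ofReal_le_uniformGr_projBall hd A V hε)
  have hexp : r * d ≤ 2 * (r * m) := by
    rw [mul_left_comm]
    exact Nat.mul_le_mul_left r (by omega)
  have hconst : (1 / 128 : ℝ) ^ (r * m) ≤ (1 / 8) ^ (r * d) * (1 / 2) ^ (r * m) :=
    calc (1 / 128 : ℝ) ^ (r * m) = (1 / 8) ^ (2 * (r * m)) * (1 / 2) ^ (r * m) := by
          rw [pow_mul (1 / 8 : ℝ) 2, ← mul_pow]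
          norm_num
      _ ≤ (1 / 8) ^ (r * d) * (1 / 2) ^ (r * m) := by
          gcongr ?_ * _
          exact pow_le_pow_of_le_one (by norm_num) (by norm_num) hexp
  have hprod : ∀ n, 0 ≤ contractionProduct ε A.toLinearMap.singularValues n := fun n =>
    (contractionProduct_pos hε _ n).le
  exact (mul_le_mul_of_nonneg_right hconst
    (mul_nonneg (pow_nonneg (hprod m) r) (pow_nonneg (hprod r) m))).trans_eq (by ring)

theorem le_uniformGr_real_projBall (hd : r + m = d) (A : Euc d →L[ℝ] G) (V : Gr d r) {ε : ℝ}
    (hε : 0 < ε) :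
    (1 / 128) ^ (r * m) * (contractionProduct ε A.toLinearMap.singularValues m ^ r *
      contractionProduct ε A.toLinearMap.singularValues r ^ m) ≤
        (uniformGr (Nat.le.intro hd)).real (projBall A V ε) := by
  refine (ENNReal.ofReal_le_iff_le_toReal (measure_ne_top _ _)).1 ?_
  rcases le_total r m with hrm | hmr
  · exact ofReal_le_uniformGr_projBall_of_le hd hrm A V hε
  · have hd' : m + r = d := (add_comm m r).trans hd
    rw [← preimage_compl_projBall hd,
      ← Measure.map_apply (measurable_compl hd) (measurableSet_projBall A _ ε),
      uniformGr_map_compl hd, mul_comm r m, mul_comm (_ ^ r)]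
    exact ofReal_le_uniformGr_projBall_of_le hd' hmr A (compl hd V) hε

theorem uniformGr_real_projBall_pos (hd : r + m = d) (A : Euc d →L[ℝ] G) (V : Gr d r) {ε : ℝ}
    (hε : 0 < ε) : 0 < (uniformGr (Nat.le.intro hd)).real (projBall A V ε) := by
  have hP := contractionProduct_pos hε A.toLinearMap.singularValues
  exact (mul_pos (by positivity) (mul_pos (pow_pos (hP m) r) (pow_pos (hP r) m))).trans_le
    (le_uniformGr_real_projBall hd A V hε)

theorem log_inv_uniformGr_projBall_le (hd : r + m = d) (A : Euc d →L[ℝ] G) (V : Gr d r) {ε : ℝ}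
    (hε : 0 < ε) :
    Real.log (1 / (uniformGr (Nat.le.intro hd)).real (projBall A V ε)) ≤
      m / 2 * ∑ k : Fin r,
          Real.log (128 * max (A.toLinearMap.singularValues k ^ 2) (ε ^ 2) / ε ^ 2) +
        r / 2 * ∑ k : Fin m,
          Real.log (128 * max (A.toLinearMap.singularValues k ^ 2) (ε ^ 2) / ε ^ 2) := by
  have hP := contractionProduct_pos hε A.toLinearMap.singularValues
  have hPow := mul_pos (pow_pos (hP m) r) (pow_pos (hP r) m)
  have hlog := Real.log_le_log (mul_pos (by positivity) hPow)
    (le_uniformGr_real_projBall hd A V hε)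
  rw [Real.log_mul (by positivity) hPow.ne',
    Real.log_mul (pow_pos (hP m) r).ne' (pow_pos (hP r) m).ne', Real.log_pow, Real.log_pow,
    Real.log_pow, one_div, Real.log_inv] at hlog
  have hσ := A.toLinearMap.singularValues_nonneg
  rw [one_div, Real.log_inv, sum_log_mul_max_div_sq (by norm_num) hε hσ,
    sum_log_mul_max_div_sq (by norm_num) hε hσ]
  push_cast at hlog
  linarith

end ProjectionBall

section SqrtOperator

open scoped MatrixOrder

variable {d : ℕ}

/-- The operator `S^{1/2}` on `ℝ^d`, for which `ellBall S V ε` is `projBall (sqrtOperator S) V ε`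
by definition. -/
def sqrtOperator (S : Matrix (Fin d) (Fin d) ℝ) : Euc d →L[ℝ] Euc d :=
  Matrix.toEuclideanCLM (n := Fin d) (𝕜 := ℝ) (CFC.sqrt S)

theorem star_sqrtOperator_mul_self {S : Matrix (Fin d) (Fin d) ℝ} (hS : S.PosSemidef) :
    star (sqrtOperator S) * sqrtOperator S = Matrix.toEuclideanCLM (n := Fin d) (𝕜 := ℝ) S := by
  rw [sqrtOperator, ← map_star, (CFC.sqrt_nonneg S).isSelfAdjoint.star_eq, ← map_mul,
    CFC.sqrt_mul_sqrt_self S hS.nonneg]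

theorem eigval_eq_sq_singularValues {S : Matrix (Fin d) (Fin d) ℝ} (hS : S.PosSemidef)
    (k : Fin d) :
    eigval hS.isHermitian k = (sqrtOperator S).toLinearMap.singularValues k ^ 2 := by
  have hT : (sqrtOperator S).toLinearMap.adjoint ∘ₗ (sqrtOperator S).toLinearMap =
      Matrix.toEuclideanLin S :=
    congrArg ContinuousLinearMap.toLinearMap (star_sqrtOperator_mul_self hS)
  have h := (sqrtOperator S).toLinearMap.sq_singularValues_fin
    finrank_euclideanSpace (Fin.cast (Fintype.card_fin d).symm k)
  refine Eq.trans ?_ h.symm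
  change (Matrix.isSymmetric_toEuclideanLin_iff.mpr hS.isHermitian).eigenvalues
    finrank_euclideanSpace _ = _
  simp only [hT]

end SqrtOperator

end GrassmannCover

end

theorem mainTheorem5 :
    ∃ C : ℝ, 0 < C ∧
      ∀ (d r : ℕ) (hr : r ≤ d) (V : GrassmannCover.Gr d r) (ε : ℝ), 0 < ε →
        ∀ (S : Matrix (Fin d) (Fin d) ℝ) (hS : S.PosSemidef),
          0 < (GrassmannCover.uniformGr hr).real (GrassmannCover.ellBall S V ε) ∧
          Real.log (1 / (GrassmannCover.uniformGr hr).real (GrassmannCover.ellBall S V ε)) ≤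
            ((d : ℝ) - (r : ℝ)) / 2 *
                ∑ k : Fin r,
                  Real.log (C * max (GrassmannCover.eigval hS.isHermitian (Fin.castLE hr k))
                    (ε ^ 2) / ε ^ 2) +
              (r : ℝ) / 2 *
                ∑ k : Fin (d - r),
                  Real.log (C * max (GrassmannCover.eigval hS.isHermitian
                    (Fin.castLE (Nat.sub_le d r) k)) (ε ^ 2) / ε ^ 2) := by
  refine ⟨128, by norm_num, fun d r hr V ε hε S hS => ?_⟩
  have hd : r + (d - r) = d := Nat.add_sub_cancel' hr
  have hlog := GrassmannCover.log_inv_uniformGr_projBall_le hd (GrassmannCover.sqrtOperator S) V hε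
  rw [Nat.cast_sub hr] at hlog
  simp only [GrassmannCover.eigval_eq_sq_singularValues hS]
  exact ⟨GrassmannCover.uniformGr_real_projBall_pos hd (GrassmannCover.sqrtOperator S) V hε, hlog⟩
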